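/- There are a deterministic algorithm in the arithmetic (unit-cost real RAM) model of computation and an absolute constant $C$ such that the following holds. For every $n \ge 1$, every $\boldsymbol{a} = (a_1,\dots,a_n) \in \mathbb{Z}_{\ge 0}^n$ and every real $\epsilon$ with $0 < \epsilon < 1$, the algorithm, given $n$, $\boldsymbol{a}$ and $\epsilon$ as input, terminates after at most $C\, n^{10} \epsilon^{-6}$ steps and outputs a number $\widehat{V}$ with $$(1-\epsilon)\,\mathrm{Vol}(P_{\boldsymbol{a}}) \;\le\; \widehat{V} \;\le\; (1+\epsilon)\,\mathrm{Vol}(P_{\boldsymbol{a}}).$$ Here $P_{\boldsymbol{a}} = \mathrm{conv}\{\pm \boldsymbol{e}_1, \dots, \pm \boldsymbol{e}_n, \boldsymbol{a}\} \subset \mathbb{R}^n$ is the knapsack dual polytope, where $\boldsymbol{e}_1,\dots,\boldsymbol{e}_n$ is the standard basis, and $\mathrm{Vol}$ is $n$-dimensional Lebesgue measure. A step is one arithmetic operation ($+,-,\times,\div$) or comparison on numbers (no rounding operation is available), or one addition, subtraction, comparison, assignment, conversion of a counter to a number, or direct or indirect memory access involving counters and addresses, or one control step. In particular the bound does not depend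 on the size of the entries of $\boldsymbol{a}$. -/

import Mathlib

open MeasureTheory

/-- The knapsack dual polytope `P_a = conv {± e_1, …, ± e_n, a}` in `ℝ^n`. -/
def knapsackDualPolytope {n : ℕ} (a : Fin n → ℕ) : Set (Fin n → ℝ) :=
  convexHull ℝ
    (Set.range (fun i : Fin n => (Pi.single i 1 : Fin n → ℝ)) ∪
      Set.range (fun i : Fin n => -(Pi.single i 1 : Fin n → ℝ)) ∪
      {fun i => (a i : ℝ)})

namespace RealRAM

/-! A unit-cost random access machine over the real numbers (the arithmetic model of computation).

The memory consists of index cells, which hold natural numbers and serve as counters and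
addresses, and of value cells, which hold real numbers. Both memories can be addressed indirectly.
The arithmetic of values is `+`, `-`, `*`, `/`; there is no rounding and no way to turn a value
into an index, and the only constants of a program are natural numbers. Every instruction and
every evaluation of a test takes one unit of time. -/

/-- A memory content. -/
structure State where
  /-- the index cells -/
  idx : ℕ → ℕ
  /-- the value cells -/
  val : ℕ → ℝ

/-- The instructions. The arguments are addresses of cells, except for `k` in `idxConst`. -/
inductive Instr where
  /-- `idx[i] := k` -/
  | idxConst (i k : ℕ)
  /-- `idx[i] := idx[j] + idx[k]` -/
  | idxAdd (i j k : ℕ)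
  /-- `idx[i] := max (idx[j] - idx[k]) 0` -/
  | idxSub (i j k : ℕ)
  /-- `idx[i] := idx[idx[j]]` -/
  | idxLoad (i j : ℕ)
  /-- `idx[idx[i]] := idx[j]` -/
  | idxStore (i j : ℕ)
  /-- `val[r] := idx[i]` -/
  | valOfIdx (r i : ℕ)
  /-- `val[r] := val[s] + val[t]` -/
  | valAdd (r s t : ℕ)
  /-- `val[r] := val[s] - val[t]` -/
  | valSub (r s t : ℕ)
  /-- `val[r] := val[s] * val[t]` -/
  | valMul (r s t : ℕ)
  /-- `val[r] := val[s] / val[t]`, where a division by zero gives zero -/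
  | valDiv (r s t : ℕ)
  /-- `val[r] := val[idx[j]]` -/
  | valLoad (r j : ℕ)
  /-- `val[idx[i]] := val[s]` -/
  | valStore (i s : ℕ)

/-- The effect of an instruction on the memory. -/
noncomputable def Instr.apply : Instr → State → State
  | .idxConst i k, σ => { σ with idx := Function.update σ.idx i k }
  | .idxAdd i j k, σ => { σ with idx := Function.update σ.idx i (σ.idx j + σ.idx k) }
  | .idxSub i j k, σ => { σ with idx := Function.update σ.idx i (σ.idx j - σ.idx k) }
  | .idxLoad i j, σ => { σ with idx := Function.update σ.idx i (σ.idx (σ.idx j)) }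
  | .idxStore i j, σ => { σ with idx := Function.update σ.idx (σ.idx i) (σ.idx j) }
  | .valOfIdx r i, σ => { σ with val := Function.update σ.val r (σ.idx i : ℝ) }
  | .valAdd r s t, σ => { σ with val := Function.update σ.val r (σ.val s + σ.val t) }
  | .valSub r s t, σ => { σ with val := Function.update σ.val r (σ.val s - σ.val t) }
  | .valMul r s t, σ => { σ with val := Function.update σ.val r (σ.val s * σ.val t) }
  | .valDiv r s t, σ => { σ with val := Function.update σ.val r (σ.val s / σ.val t) }
  | .valLoad r j, σ => { σ with val := Function.update σ.val r (σ.val (σ.idx j)) }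
  | .valStore i s, σ => { σ with val := Function.update σ.val (σ.idx i) (σ.val s) }

/-- The tests: comparisons of two index cells or of two value cells. -/
inductive Test where
  /-- `idx[i] ≤ idx[j]` -/
  | idxLe (i j : ℕ)
  /-- `idx[i] < idx[j]` -/
  | idxLt (i j : ℕ)
  /-- `val[r] ≤ val[s]` -/
  | valLe (r s : ℕ)
  /-- `val[r] < val[s]` -/
  | valLt (r s : ℕ)

/-- The truth of a test in a memory content. -/
def Test.Holds : Test → State → Prop
  | .idxLe i j, σ => σ.idx i ≤ σ.idx j
  | .idxLt i j, σ => σ.idx i < σ.idx j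
  | .valLe r s, σ => σ.val r ≤ σ.val s
  | .valLt r s, σ => σ.val r < σ.val s

/-- The programs. -/
inductive Program where
  | skip
  | instr (c : Instr)
  | seq (P Q : Program)
  | ite (b : Test) (P Q : Program)
  | while (b : Test) (P : Program)

/-- `Runs P σ σ' t`: the program `P`, started with memory content `σ`, terminates with memory
content `σ'` after exactly `t` units of time. -/
inductive Runs : Program → State → State → ℕ → Prop
  | skip (σ : State) : Runs .skip σ σ 1
  | instr (c : Instr) (σ : State) : Runs (.instr c) σ (c.apply σ) 1
  | seq {P Q : Program} {σ σ' σ'' : State} {t u : ℕ} :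
      Runs P σ σ' t → Runs Q σ' σ'' u → Runs (.seq P Q) σ σ'' (t + u)
  | ite_true {b : Test} {P Q : Program} {σ σ' : State} {t : ℕ} :
      b.Holds σ → Runs P σ σ' t → Runs (.ite b P Q) σ σ' (1 + t)
  | ite_false {b : Test} {P Q : Program} {σ σ' : State} {t : ℕ} :
      ¬ b.Holds σ → Runs Q σ σ' t → Runs (.ite b P Q) σ σ' (1 + t)
  | while_true {b : Test} {P : Program} {σ σ' σ'' : State} {t u : ℕ} :
      b.Holds σ → Runs P σ σ' t → Runs (.while b P) σ' σ'' u →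
      Runs (.while b P) σ σ'' (1 + t + u)
  | while_false {b : Test} {P : Program} {σ : State} :
      ¬ b.Holds σ → Runs (.while b P) σ σ 1

/-- Programs are deterministic: the initial memory content determines the final memory content
and the running time. -/
theorem Runs.deterministic {P : Program} {σ σ₁ σ₂ : State} {t₁ t₂ : ℕ}
    (h₁ : Runs P σ σ₁ t₁) (h₂ : Runs P σ σ₂ t₂) : σ₁ = σ₂ ∧ t₁ = t₂ := by
  induction h₁ generalizing σ₂ t₂ with
  | skip σ => cases h₂; exact ⟨rfl, rfl⟩
  | instr c σ => cases h₂; exact ⟨rfl, rfl⟩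
  | seq _ _ ih ih' =>
    cases h₂ with
    | seq k k' =>
      obtain ⟨rfl, rfl⟩ := ih k
      obtain ⟨rfl, rfl⟩ := ih' k'
      exact ⟨rfl, rfl⟩
  | ite_true hb _ ih =>
    cases h₂ with
    | ite_true _ k => obtain ⟨rfl, rfl⟩ := ih k; exact ⟨rfl, rfl⟩
    | ite_false hb' _ => exact absurd hb hb'
  | ite_false hb _ ih =>
    cases h₂ with
    | ite_true hb' _ => exact absurd hb' hb
    | ite_false _ k => obtain ⟨rfl, rfl⟩ := ih k; exact ⟨rfl, rfl⟩
  | while_true hb _ _ ih ih' =>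
    cases h₂ with
    | while_true _ k k' =>
      obtain ⟨rfl, rfl⟩ := ih k
      obtain ⟨rfl, rfl⟩ := ih' k'
      exact ⟨rfl, rfl⟩
    | while_false hb' => exact absurd hb hb'
  | while_false hb =>
    cases h₂ with
    | while_true hb' _ _ => exact absurd hb' hb
    | while_false _ => exact ⟨rfl, rfl⟩

/-- The initial memory content for the input `(n, ε, a)`: `idx[0] = n`, `val[0] = ε`,
`val[i] = a_i` for `i = 1, …, n`, and zero in every other cell. -/
noncomputable def input {n : ℕ} (ε : ℝ) (a : Fin n → ℕ) : State where
  idx := fun j => if j = 0 then n else 0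
  val := fun j => if j = 0 then ε else if h : j - 1 < n then (a ⟨j - 1, h⟩ : ℝ) else 0

/-- The output of a computation is the final content of `val[0]`. -/
def State.output (σ : State) : ℝ := σ.val 0

end RealRAM

/-! The facets of the cross-polytope correspond to sign vectors `s`. Coning from `a` over the facets
that it does not see, those with `s • a < 1`, triangulates the polytope up to null sets. Such a
simplex has volume `(1 - s • a) / n!`, so `n! * Vol` is the sum of `max 0 (1 - s • a)` over all `s`
(`volume_knapsackDualPolytope`). With `S = ∑ a i`, passing from `s` to subsets turns the terms into
`max 0 (1 - S + 2 * ∑ i ∈ A, a i)`.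

For large entries this sum is still too long to tabulate by exact subset sums. Each `a i` is
therefore rounded down to `b i * δ` with `δ = ε * (1 + S) / (2 * n) ^ 2`. Then `∑ b i ≤ (2 * n) ^ 2
/ ε` whatever the size of `a`, and dynamic programming counts the subsets with each rounded sum in
`O(n ^ 3 / ε)` steps (`volumeProgram_spec`).

Every term changes by at most `2 * n * δ` (`abs_sum_powerset_sub_le`). This absolute error is a
relative error of at most `ε` because the sum is at least `2 ^ n * (1 + S) / (2 * n)`
(`sum_le_signSum`). -/

/-- The sign vector with value `1` on `A` and `-1` off `A`. -/
def signVec {ι : Type*} [DecidableEq ι] (A : Finset ι) (i : ι) : ℝ := if i ∈ A then 1 else -1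

/-! ### Triangulation and volume of the polytope. -/

section Geometry

variable {n : ℕ}

theorem signVec_mul_self {ι : Type*} [DecidableEq ι] (A : Finset ι) (i : ι) :
    signVec A i * signVec A i = 1 := by
  unfold signVec; split_ifs <;> norm_num

theorem abs_signVec {ι : Type*} [DecidableEq ι] (A : Finset ι) (i : ι) : |signVec A i| = 1 := by
  unfold signVec; split_ifs <;> simp

theorem signVec_mul_le_abs {ι : Type*} [DecidableEq ι] (A : Finset ι) (i : ι) (x : ℝ) :
    signVec A i * x ≤ |x| :=
  (le_abs_self _).trans (by rw [abs_mul, abs_signVec, one_mul])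

/-- The map taking the corner simplex to the simplex spanned by `a` and the facet with signs `A` of
the cross-polytope. -/
def apexMap (a : Fin n → ℝ) (A : Finset (Fin n)) (y : Fin n → ℝ) : Fin n → ℝ :=
  fun i => signVec A i * y i + (1 - ∑ j, y j) * a i

/-- The convex hull of the origin and the standard basis vectors. -/
def cornerSimplex (n : ℕ) : Set (Fin n → ℝ) := {y | (∀ i, 0 ≤ y i) ∧ ∑ i, y i ≤ 1}

/-- The interior of the corner simplex. -/
def openCornerSimplex (n : ℕ) : Set (Fin n → ℝ) := {y | (∀ i, 0 < y i) ∧ ∑ i, y i < 1}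

theorem convex_cornerSimplex : Convex ℝ (cornerSimplex n) := by
  rintro x ⟨hx, hx'⟩ y ⟨hy, hy'⟩ s t hs ht hst
  refine ⟨fun i => ?_, ?_⟩
  · have := hx i
    have := hy i
    simp only [Pi.add_apply, Pi.smul_apply, smul_eq_mul]
    positivity
  · simp only [Pi.add_apply, Pi.smul_apply, smul_eq_mul, Finset.sum_add_distrib, ← Finset.mul_sum]
    nlinarith

theorem isOpen_openCornerSimplex : IsOpen (openCornerSimplex n) := by
  have : openCornerSimplex n = (⋂ i, {y | 0 < y i}) ∩ {y | ∑ i, y i < 1} := by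
    ext; simp [openCornerSimplex]
  rw [this]
  exact (isOpen_iInter_of_finite fun i => isOpen_lt continuous_const (continuous_apply i)).inter
    (isOpen_lt (by fun_prop) continuous_const)

theorem interior_cornerSimplex_subset : interior (cornerSimplex n) ⊆ openCornerSimplex n := by
  intro y hy
  have hpos : ∀ i, 0 < y i := by
    intro i
    have h : cornerSimplex n ⊆ (fun z : Fin n → ℝ => z i) ⁻¹' Set.Ici 0 := fun z hz => hz.1 i
    have h' := interior_mono h hy
    rw [← (isOpenMap_eval i).preimage_interior_eq_interior_preimage (continuous_apply i)] at h'
    simpa using h'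
  refine ⟨hpos, ?_⟩
  -- In dimension zero the sum is empty; otherwise the coordinate sum is a surjective functional,
  -- hence an open map.
  rcases Nat.eq_zero_or_pos n with rfl | hn
  · simp
  let f : (Fin n → ℝ) →ₗ[ℝ] ℝ := ∑ i, LinearMap.proj i
  have hf : ∀ z, f z = ∑ i, z i := fun z => by simp [f]
  have hsurj : Function.Surjective f := fun c =>
    ⟨Pi.single ⟨0, hn⟩ c, by simp [hf, Finset.sum_pi_single']⟩
  have h : cornerSimplex n ⊆ f ⁻¹' Set.Iic 1 := fun z hz => by simpa [hf] using hz.2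
  have h' := interior_mono h hy
  rw [← (f.isOpenMap_of_finiteDimensional hsurj).preimage_interior_eq_interior_preimage
    f.continuous_of_finiteDimensional] at h'
  simpa [hf] using h'

theorem volume_openCornerSimplex :
    volume (openCornerSimplex n) = volume (cornerSimplex n) := by
  refine le_antisymm (measure_mono fun y hy => ⟨fun i => (hy.1 i).le, hy.2.le⟩) ?_
  calc volume (cornerSimplex n)
      ≤ volume (interior (cornerSimplex n) ∪ frontier (cornerSimplex n)) := by
        apply measure_mono
        rw [← closure_eq_interior_union_frontier]
        exact subset_closure
    _ ≤ volume (interior (cornerSimplex n)) + volume (frontier (cornerSimplex n)) :=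
        measure_union_le _ _
    _ = volume (interior (cornerSimplex n)) := by
        rw [convex_cornerSimplex.addHaar_frontier volume, add_zero]
    _ ≤ _ := measure_mono interior_cornerSimplex_subset

open Matrix in
-- The linear part is a diagonal sign matrix times a rank-one update of the identity, so the matrix
-- determinant lemma gives its determinant.
theorem volume_image_apexMap (a : Fin n → ℝ) (A : Finset (Fin n)) (S : Set (Fin n → ℝ)) :
    volume (apexMap a A '' S) = ENNReal.ofReal |1 - ∑ i, signVec A i * a i| * volume S := by
  let M : Matrix (Fin n) (Fin n) ℝ := diagonal (signVec A) *
    (1 + replicateCol Unit (fun i : Fin n => - (signVec A i * a i)) *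
      replicateRow Unit (fun _ : Fin n => (1 : ℝ)))
  have hM : apexMap a A = (fun x => a + x) ∘ toLin' M := by
    funext y
    ext i
    simp only [M, Function.comp, Pi.add_apply, toLin'_apply, ← mulVec_mulVec, mulVec_diagonal,
      add_mulVec, one_mulVec, apexMap]
    simp only [mulVec, dotProduct, replicateRow_apply, replicateCol_apply, one_mul,
      Finset.univ_unique, Finset.sum_singleton]
    linear_combination (a i * ∑ j, y j) * signVec_mul_self A i
  have hdet : |LinearMap.det (toLin' M)| = |1 - ∑ i, signVec A i * a i| := by
    rw [LinearMap.det_toLin', det_mul, det_diagonal, det_one_add_replicateCol_mul_replicateRow,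
      abs_mul, Finset.abs_prod]
    simp [abs_signVec, dotProduct, sub_eq_add_neg]
  rw [hM, Set.image_comp, Set.image_add_left, measure_preimage_add,
    Measure.addHaar_image_linearMap, hdet]

/-- The points `x` which are convex combinations of `a` and a point of the cross-polytope. -/
def apexBody (a : Fin n → ℝ) : Set (Fin n → ℝ) :=
  {x | ∃ l : ℝ, 0 ≤ l ∧ l ≤ 1 ∧ ∑ i, |x i - l * a i| ≤ 1 - l}

theorem convex_apexBody (a : Fin n → ℝ) : Convex ℝ (apexBody a) := by
  rintro x ⟨l, h0, h1, h⟩ y ⟨m, k0, k1, k⟩ s t hs ht hst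
  refine ⟨s * l + t * m, by positivity, by nlinarith, ?_⟩
  calc ∑ i, |(s • x + t • y) i - (s * l + t * m) * a i|
      ≤ ∑ i, (s * |x i - l * a i| + t * |y i - m * a i|) := by
        refine Finset.sum_le_sum fun i _ => ?_
        rw [← abs_of_nonneg hs, ← abs_of_nonneg ht, ← abs_mul, ← abs_mul, abs_of_nonneg hs,
          abs_of_nonneg ht]
        refine le_of_eq_of_le ?_ (abs_add_le _ _)
        simp only [Pi.add_apply, Pi.smul_apply, smul_eq_mul]
        congr 1
        ring
    _ = s * ∑ i, |x i - l * a i| + t * ∑ i, |y i - m * a i| := by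
        rw [Finset.sum_add_distrib, Finset.mul_sum, Finset.mul_sum]
    _ ≤ s * (1 - l) + t * (1 - m) := by gcongr
    _ = 1 - (s * l + t * m) := by linear_combination hst

open Filter Topology in
-- Take the largest admissible weight `l` of `a` in `x`. The remainder `x - l • a` then lies on the
-- boundary of the cross-polytope scaled by `1 - l`, and its signs name a facet that `a` does not
-- see, since otherwise `l` could be increased.
theorem apexBody_subset (a : Fin n → ℝ) (ha : ∀ i, 0 ≤ a i) :
    apexBody a ⊆ ⋃ A ∈ Finset.univ.filter
      (fun A : Finset (Fin n) => ∑ i, signVec A i * a i < 1), apexMap a A '' cornerSimplex n := by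
  rintro x ⟨l₀, h0, h1, h⟩
  let h : ℝ → ℝ := fun l => ∑ i, |x i - l * a i| + l
  have hcont : Continuous h := by fun_prop
  have hcomp : IsCompact (Set.Icc 0 1 ∩ {l | h l ≤ 1}) :=
    isCompact_Icc.inter_right (isClosed_le hcont continuous_const)
  obtain ⟨l, ⟨⟨hl0, hl1⟩, hl⟩, hmax⟩ :=
    hcomp.exists_isGreatest ⟨l₀, ⟨h0, h1⟩, by simp only [h, Set.mem_ofPred_eq]; linarith⟩
  change h l ≤ 1 at hl
  simp only [Set.mem_iUnion, Finset.mem_filter, Finset.mem_univ, true_and, exists_prop]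
  have hkey : ∀ m, l < m → m ≤ 1 → 1 < h m := by
    intro m hm hm1
    by_contra! hc
    exact absurd (hmax ⟨⟨hl0.trans hm.le, hm1⟩, hc⟩) (not_le.2 hm)
  rcases hl1.eq_or_lt with rfl | hl1
  · have hx : ∀ i, x i = a i := by
      have : ∑ i, |x i - 1 * a i| ≤ 0 := by simpa [h] using hl
      have h0 := (Finset.sum_eq_zero_iff_of_nonneg fun i _ => abs_nonneg _).1
        (le_antisymm this (Finset.sum_nonneg fun i _ => abs_nonneg _))
      intro i
      have := abs_eq_zero.1 (h0 i (Finset.mem_univ i))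
      linarith
    -- Here `x = a` is the apex, common to all simplices; the all-negative facet is never visible
    -- because `a` is nonnegative.
    refine ⟨∅, ?_, 0, ⟨fun i => le_rfl, by simp⟩, ?_⟩
    · have : 0 ≤ ∑ i, a i := Finset.sum_nonneg fun i _ => ha i
      simp only [signVec, Finset.notMem_empty, if_false, neg_one_mul, Finset.sum_neg_distrib]
      linarith
    · ext i
      simp [apexMap, hx]
  let A : Finset (Fin n) := Finset.univ.filter fun i => 0 < x i - l * a i
  have hA : ∀ i, i ∈ A ↔ 0 < x i - l * a i := fun i => by simp [A]
  have habs : ∀ i, |x i - l * a i| = signVec A i * (x i - l * a i) := by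
    intro i
    unfold signVec
    split_ifs with hi
    · rw [abs_of_pos ((hA i).1 hi), one_mul]
    · rw [abs_of_nonpos (not_lt.1 fun h => hi ((hA i).2 h)), neg_one_mul]
  have hev : ∀ᶠ m in 𝓝[>] l, l < m ∧ m ≤ 1 ∧ (∀ i, i ∈ A → 0 < x i - m * a i) := by
    refine (eventually_mem_nhdsWithin).and (Filter.Eventually.and ?_ ?_)
    · exact nhdsWithin_le_nhds ((eventually_lt_nhds hl1).mono fun _ h => h.le)
    · refine nhdsWithin_le_nhds (eventually_all.2 fun i => ?_)
      by_cases hi : i ∈ A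
      · have : ContinuousAt (fun m => x i - m * a i) l := by fun_prop
        exact (this.eventually (eventually_gt_nhds ((hA i).1 hi))).mono fun _ h _ => h
      · exact Eventually.of_forall fun _ h => absurd h hi
  have heq : h l = 1 := by
    refine le_antisymm hl (not_lt.1 fun hlt => ?_)
    have : ∀ᶠ m in 𝓝[>] l, h m < 1 :=
      nhdsWithin_le_nhds (hcont.continuousAt.eventually (eventually_lt_nhds hlt))
    obtain ⟨m, ⟨hm, hm1, -⟩, hm2⟩ := (hev.and this).exists
    exact absurd (hkey m hm hm1) (not_lt.2 hm2.le)
  have hsum : ∑ i, |x i - l * a i| = 1 - l := by simp only [h] at heq; linarith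
  refine ⟨A, ?_, fun i => |x i - l * a i|, ⟨fun i => abs_nonneg _, by linarith⟩, ?_⟩
  · obtain ⟨m, hm, hm1, hmA⟩ := hev.exists
    have hmabs : ∀ i, |x i - m * a i| = signVec A i * (x i - m * a i) := by
      intro i
      unfold signVec
      split_ifs with hi
      · rw [abs_of_pos (hmA i hi), one_mul]
      -- A coordinate that is nonpositive at `l`, possibly zero, stays nonpositive at `m > l`
      -- because `a i ≥ 0`.
      · have h1 := not_lt.1 fun h => hi ((hA i).2 h)
        rw [abs_of_nonpos (by nlinarith [ha i]), neg_one_mul]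
    have h1 := hkey m hm hm1
    -- With constant signs `h` is affine; as it increases past `l`, its slope `1 - s • a` is
    -- positive.
    have h2 : h m = h l + (m - l) * (1 - ∑ i, signVec A i * a i) := by
      simp only [h, hmabs, habs, mul_sub, Finset.sum_sub_distrib, Finset.mul_sum]
      have e : ∀ c : ℝ, ∑ i, signVec A i * (c * a i) = c * ∑ i, signVec A i * a i := fun c => by
        rw [Finset.mul_sum]; exact Finset.sum_congr rfl fun i _ => by ring
      simp only [e, ← Finset.mul_sum]
      ring
    nlinarith
  · ext i
    simp only [apexMap, hsum]
    rw [habs, ← mul_assoc, signVec_mul_self]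
    ring

theorem openCornerSimplex_image_subset_apexBody (a : Fin n → ℝ) (A : Finset (Fin n)) :
    apexMap a A '' openCornerSimplex n ⊆ apexBody a := by
  rintro _ ⟨y, ⟨hy, hy1⟩, rfl⟩
  have : 0 ≤ ∑ i, y i := Finset.sum_nonneg fun i _ => (hy i).le
  refine ⟨1 - ∑ i, y i, by linarith, by linarith, le_of_eq ?_⟩
  simp [apexMap, abs_mul, abs_signVec, abs_of_pos (hy _)]

/-- For a common point, multiplying by the signs of `A` and summing gives `(∑ y - ∑ z) * (1 - s • a)
≤ 0`. By symmetry the weights of `a` agree, and then the strict positivity of the other coordinates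
forces equal signs. -/
theorem pairwiseDisjoint_image_openCornerSimplex (a : Fin n → ℝ) :
    {A : Finset (Fin n) | ∑ i, signVec A i * a i < 1}.PairwiseDisjoint
      (fun A => apexMap a A '' openCornerSimplex n) := by
  have key : ∀ A B : Finset (Fin n), ∑ i, signVec A i * a i < 1 →
      ∀ y ∈ openCornerSimplex n, ∀ z ∈ openCornerSimplex n,
      apexMap a A y = apexMap a B z → ∑ i, y i ≤ ∑ i, z i := by
    intro A B hA y hy z hz h
    by_contra! hlt
    have h1 : ∑ i, signVec A i * (signVec B i * z i) ≤ ∑ i, z i :=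
      Finset.sum_le_sum fun i _ => (signVec_mul_le_abs A i _).trans
        (by rw [abs_mul, abs_signVec, one_mul, abs_of_pos (hz.1 i)])
    have h2 : ∀ i, signVec A i * (signVec B i * z i) =
        y i + (∑ j, z j - ∑ j, y j) * (signVec A i * a i) := by
      intro i
      have := congrFun h i
      simp only [apexMap] at this
      linear_combination y i * signVec_mul_self A i - signVec A i * this
    simp only [h2, Finset.sum_add_distrib, ← Finset.mul_sum] at h1
    nlinarith
  intro A hA B hB hAB
  refine Set.disjoint_left.2 ?_
  rintro _ ⟨y, hy, rfl⟩ ⟨z, hz, h⟩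
  have hs : ∑ i, y i = ∑ i, z i :=
    le_antisymm (key A B hA y hy z hz h.symm) (key B A hB z hz y hy h)
  apply hAB
  ext i
  have hi := congrFun h i
  have hyi := hy.1 i
  have hzi := hz.1 i
  simp only [apexMap, hs, add_left_inj, signVec] at hi
  by_cases h1 : i ∈ A <;> by_cases h2 : i ∈ B <;> simp only [h1, h2, if_true, if_false] at hi ⊢ <;>
    linarith

theorem measurableSet_image_apexMap (a : Fin n → ℝ) (A : Finset (Fin n))
    (hA : ∑ i, signVec A i * a i < 1) : MeasurableSet (apexMap a A '' openCornerSimplex n) := by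
  have hc : Continuous (apexMap a A) := by unfold apexMap; fun_prop
  refine isOpen_openCornerSimplex.measurableSet.image_of_continuousOn_injOn hc.continuousOn ?_
  intro y _ z _ h
  have h2 : ∀ i, y i - z i =
      (∑ j, y j - ∑ j, z j) * (signVec A i * a i) := by
    intro i
    have := congrFun h i
    simp only [apexMap] at this
    linear_combination signVec A i * this - (y i - z i) * signVec_mul_self A i
  have h3 : ∑ i, y i - ∑ i, z i = (∑ j, y j - ∑ j, z j) * ∑ i, signVec A i * a i := by
    rw [Finset.mul_sum]
    exact (Finset.sum_sub_distrib _ _).symm.trans (Finset.sum_congr rfl fun i _ => h2 i)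
  have h4 : ∑ j, y j - ∑ j, z j = 0 := by
    by_contra hne
    apply hA.ne
    exact mul_left_cancel₀ hne (by linarith)
  ext i
  have := h2 i
  rw [h4] at this
  linarith

/-- The closed simplices cover `S`, the open ones are disjoint inside it, and both have the same
total volume. -/
theorem volume_of_between_apexBody (a : Fin n → ℝ) (ha : ∀ i, 0 ≤ a i) (S : Set (Fin n → ℝ))
    (hS : S ⊆ apexBody a) (hS' : ∀ A, apexMap a A '' openCornerSimplex n ⊆ S) :
    volume S = ENNReal.ofReal (∑ A : Finset (Fin n), max 0 (1 - ∑ i, signVec A i * a i)) *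
      volume (cornerSimplex n) := by
  have hsum : ENNReal.ofReal (∑ A : Finset (Fin n), max 0 (1 - ∑ i, signVec A i * a i)) *
      volume (cornerSimplex n) = ∑ A ∈ Finset.univ.filter
      (fun A : Finset (Fin n) => ∑ i, signVec A i * a i < 1),
        ENNReal.ofReal |1 - ∑ i, signVec A i * a i| * volume (cornerSimplex n) := by
    rw [← Finset.sum_mul, ← ENNReal.ofReal_sum_of_nonneg fun _ _ => abs_nonneg _,
      Finset.sum_filter]
    congr 2
    refine Finset.sum_congr rfl fun A _ => ?_
    split_ifs with h
    · rw [max_eq_right (by linarith), abs_of_pos (by linarith)]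
    · rw [max_eq_left (by linarith)]
  rw [hsum]
  apply le_antisymm
  · refine (measure_mono (hS.trans (apexBody_subset a ha))).trans
      ((measure_biUnion_finset_le _ _).trans (le_of_eq ?_))
    exact Finset.sum_congr rfl fun A _ => volume_image_apexMap a A _
  · calc _ = ∑ A ∈ Finset.univ.filter (fun A : Finset (Fin n) => ∑ i, signVec A i * a i < 1),
        volume (apexMap a A '' openCornerSimplex n) :=
        Finset.sum_congr rfl fun A _ => by rw [volume_image_apexMap, volume_openCornerSimplex]
      _ = volume (⋃ A ∈ Finset.univ.filter
          (fun A : Finset (Fin n) => ∑ i, signVec A i * a i < 1),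
          apexMap a A '' openCornerSimplex n) := by
        rw [measure_biUnion_finset]
        · simpa using pairwiseDisjoint_image_openCornerSimplex a
        · exact fun A hA => measurableSet_image_apexMap a A (Finset.mem_filter.1 hA).2
      _ ≤ volume S := measure_mono (Set.iUnion₂_subset fun A _ => hS' A)

/-- For `a = 0` the triangulation cuts the `ℓ¹` ball into `2 ^ n` copies of the corner simplex, and
the volume of that ball is known. -/
theorem volume_cornerSimplex (hn : 1 ≤ n) :
    volume (cornerSimplex n) = ENNReal.ofReal (1 / n.factorial) := by
  have : Nonempty (Fin n) := ⟨⟨0, hn⟩⟩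
  have h1 := volume_of_between_apexBody (0 : Fin n → ℝ) (fun _ => le_rfl) (apexBody 0) subset_rfl
    (openCornerSimplex_image_subset_apexBody 0)
  have h2 : apexBody (0 : Fin n → ℝ) =
      {x : Fin n → ℝ | (∑ i, |x i| ^ (1 : ℝ)) ^ (1 / (1 : ℝ)) ≤ 1} := by
    ext x
    simp only [apexBody, Pi.zero_apply, mul_zero, sub_zero, Set.mem_ofPred_eq, Real.rpow_one,
      div_one]
    exact ⟨fun ⟨l, h0, _, h⟩ => by linarith, fun h => ⟨0, le_rfl, zero_le_one, by linarith⟩⟩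
  have h3 := MeasureTheory.volume_sum_rpow_le (Fin n) (le_refl (1 : ℝ)) 1
  rw [← h2, h1] at h3
  have hG : Real.Gamma (1 / 1 + 1) = 1 := by
    rw [div_one]; simpa using Real.Gamma_nat_eq_factorial 1
  simp only [Pi.zero_apply, mul_zero, Finset.sum_const_zero, sub_zero, max_eq_right zero_le_one,
    Finset.sum_const, Finset.card_univ, Fintype.card_finset, Fintype.card_fin, nsmul_eq_mul,
    mul_one, ENNReal.ofReal_one, one_pow, one_mul, hG] at h3
  simp only [div_one, Real.Gamma_nat_eq_factorial] at h3
  have h4 : ENNReal.ofReal ((2 ^ n : ℕ) : ℝ) ≠ 0 := by simp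
  refine (ENNReal.mul_right_inj h4 ENNReal.ofReal_ne_top).1 (h3.trans ?_)
  rw [← ENNReal.ofReal_mul (by positivity)]
  congr 1
  push_cast
  ring

theorem volume_knapsackDualPolytope (hn : 1 ≤ n) (a : Fin n → ℕ) :
    volume.real (knapsackDualPolytope a) =
      (∑ A : Finset (Fin n), max 0 (1 - ∑ i, signVec A i * a i)) / n.factorial := by
  have h := volume_of_between_apexBody (fun i => (a i : ℝ)) (fun i => Nat.cast_nonneg _)
    (knapsackDualPolytope a) ?_ ?_
  · rw [Measure.real, h, volume_cornerSimplex hn, ← ENNReal.ofReal_mul, ENNReal.toReal_ofReal]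
    · ring
    · exact mul_nonneg (Finset.sum_nonneg fun _ _ => le_max_left _ _) (by positivity)
    · exact Finset.sum_nonneg fun _ _ => le_max_left _ _
  · refine convexHull_min ?_ (convex_apexBody _)
    rintro x ((⟨j, rfl⟩ | ⟨j, rfl⟩) | rfl)
    · refine ⟨0, le_rfl, zero_le_one, ?_⟩
      simp [Pi.single_apply, apply_ite abs]
    · refine ⟨0, le_rfl, zero_le_one, ?_⟩
      simp [Pi.single_apply, apply_ite abs]
    · exact ⟨1, zero_le_one, le_rfl, by simp⟩
  · rintro A _ ⟨y, ⟨hy, hy1⟩, rfl⟩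
    have hsub : _ ⊆ knapsackDualPolytope a := subset_convexHull ℝ _
    -- In the index type `Option (Fin n)`, `none` stands for the apex `a` and `some i` for a signed
    -- basis vector.
    have hmem := (convex_convexHull ℝ _).sum_mem (t := Finset.univ)
      (w := fun o : Option (Fin n) => o.elim (1 - ∑ i, y i) y)
      (z := fun o => o.elim (fun i => (a i : ℝ)) (fun i => signVec A i • Pi.single i 1))
      (s := knapsackDualPolytope a) ?_ ?_ ?_
    · convert hmem using 1
      ext i
      simp [Fintype.sum_option, apexMap, Pi.single_apply]
      ring
    · rintro (_ | i) _
      · simpa using hy1.le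
      · exact (hy i).le
    · simp [Fintype.sum_option]
    · rintro (_ | i) _
      · exact hsub (Or.inr rfl)
      · simp only [Option.elim_some, signVec]
        by_cases hi : i ∈ A
        · simpa only [hi, if_true, one_smul] using hsub (Or.inl (Or.inl ⟨i, rfl⟩))
        · simpa only [hi, if_false, neg_one_smul] using hsub (Or.inl (Or.inr ⟨i, rfl⟩))

end Geometry

/-! ### Counting subsets by their sum. -/

/-- The number of subsets of `{0, …, m - 1}` with `b`-sum equal to `j`. -/
def subsetSumCount (b : ℕ → ℕ) (m j : ℕ) : ℝ :=
  ∑ A ∈ (Finset.range m).powerset, if ∑ i ∈ A, b i = j then 1 else 0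

theorem subsetSumCount_zero (b : ℕ → ℕ) (j : ℕ) :
    subsetSumCount b 0 j = if j = 0 then 1 else 0 := by
  simp only [subsetSumCount, Finset.range_zero, Finset.powerset_empty, Finset.sum_singleton,
    Finset.sum_empty]
  exact if_congr eq_comm rfl rfl

/-- The dynamic programming recursion: a subset either omits or contains the item `m`. -/
theorem subsetSumCount_succ (b : ℕ → ℕ) (m j : ℕ) :
    subsetSumCount b (m + 1) j =
      subsetSumCount b m j + if b m ≤ j then subsetSumCount b m (j - b m) else 0 := by
  unfold subsetSumCount
  rw [Finset.range_add_one, Finset.sum_powerset_insert Finset.notMem_range_self]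
  congr 1
  have h : ∀ A ∈ (Finset.range m).powerset, ∑ i ∈ insert m A, b i = b m + ∑ i ∈ A, b i :=
    fun A hA => Finset.sum_insert fun hm =>
      Finset.notMem_range_self (Finset.mem_powerset.1 hA hm)
  rw [Finset.sum_congr rfl fun A hA => by rw [h A hA]]
  split_ifs with hb
  · exact Finset.sum_congr rfl fun A _ => if_congr (by omega) rfl rfl
  · exact Finset.sum_eq_zero fun A _ => if_neg (by omega)

theorem sum_le_sum_range_of_mem_powerset (b : ℕ → ℕ) (m : ℕ) {A : Finset ℕ}
    (hA : A ∈ (Finset.range m).powerset) : ∑ i ∈ A, b i ≤ ∑ i ∈ Finset.range m, b i :=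
  Finset.sum_le_sum_of_subset (Finset.mem_powerset.1 hA)

theorem subsetSumCount_eq_zero (b : ℕ → ℕ) (m j : ℕ) (hj : ∑ i ∈ Finset.range m, b i < j) :
    subsetSumCount b m j = 0 :=
  Finset.sum_eq_zero fun _ hA =>
    if_neg ((sum_le_sum_range_of_mem_powerset b m hA).trans_lt hj).ne

theorem sum_subsetSumCount_mul (b : ℕ → ℕ) (m : ℕ) (g : ℕ → ℝ) :
    ∑ j ∈ Finset.range (∑ i ∈ Finset.range m, b i + 1), subsetSumCount b m j * g j =
      ∑ A ∈ (Finset.range m).powerset, g (∑ i ∈ A, b i) := by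
  simp only [subsetSumCount, Finset.sum_mul]
  rw [Finset.sum_comm]
  refine Finset.sum_congr rfl fun A hA => ?_
  simp only [ite_mul, one_mul, zero_mul]
  rw [Finset.sum_ite_eq, if_pos]
  exact Finset.mem_range.2 (Nat.lt_succ_of_le (sum_le_sum_range_of_mem_powerset b m hA))

/-! ### Time-bounded correctness of programs. -/

namespace RealRAM

/-- `P` started in `σ` terminates after at most `c` steps in a state satisfying `Q`. -/
def Reach (P : Program) (σ : State) (c : ℕ) (Q : State → Prop) : Prop :=
  ∃ σ' t, Runs P σ σ' t ∧ t ≤ c ∧ Q σ'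

theorem Reach.mono {P : Program} {σ : State} {c d : ℕ} {Q R : State → Prop}
    (h : Reach P σ c Q) (hcd : c ≤ d) (hQR : ∀ σ', Q σ' → R σ') : Reach P σ d R :=
  let ⟨σ', t, h1, h2, h3⟩ := h
  ⟨σ', t, h1, h2.trans hcd, hQR _ h3⟩

theorem Reach.seq {P Q : Program} {σ : State} {c d : ℕ} {R S : State → Prop}
    (h : Reach P σ c R) (h' : ∀ σ', R σ' → Reach Q σ' d S) :
    Reach (.seq P Q) σ (c + d) S :=
  let ⟨σ', _, h1, h2, h3⟩ := h
  let ⟨σ'', _, k1, k2, k3⟩ := h' σ' h3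
  ⟨σ'', _, .seq h1 k1, add_le_add h2 k2, k3⟩

/-- Straight-line programs. -/
def block : List Instr → Program
  | [] => .skip
  | c :: l => .seq (.instr c) (block l)

theorem Reach.block {l : List Instr} {σ : State} {Q : State → Prop}
    (h : Q (l.foldl (fun s c => c.apply s) σ)) : Reach (block l) σ (l.length + 1) Q := by
  induction l generalizing σ with
  | nil => exact ⟨σ, 1, .skip σ, le_rfl, h⟩
  | cons c l ih =>
    obtain ⟨σ', t, h1, h2, h3⟩ := ih h
    exact ⟨σ', _, .seq (.instr c σ) h1, by simp only [List.length_cons]; omega, h3⟩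

/-- A loop with invariant `I`, whose body takes at most `c` steps, that is left after `m` rounds. -/
theorem Reach.while {b : Test} {P : Program} {I : ℕ → State → Prop} {m c : ℕ}
    (hbody : ∀ i < m, ∀ σ, I i σ → b.Holds σ ∧ Reach P σ c (I (i + 1)))
    (hend : ∀ σ, I m σ → ¬ b.Holds σ) {σ : State} (h0 : I 0 σ) :
    Reach (.while b P) σ (m * (c + 1) + 1) (I m) := by
  have key : ∀ k ≤ m, ∀ σ, I (m - k) σ → Reach (.while b P) σ (k * (c + 1) + 1) (I m) := by
    intro k
    induction k with
    | zero => exact fun _ σ h => ⟨σ, 1, .while_false (hend σ h), by simp, h⟩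
    | succ k ih =>
      intro hk σ h
      obtain ⟨hb, σ', t, h1, h2, h3⟩ := hbody _ (by omega) σ h
      rw [show m - (k + 1) + 1 = m - k by omega] at h3
      obtain ⟨σ'', u, k1, k2, k3⟩ := ih (by omega) σ' h3
      exact ⟨σ'', _, .while_true hb h1 k1, by rw [add_mul]; omega, k3⟩
  exact key m le_rfl σ (by simpa using h0)

/-! ### Preparation of the memory and of the rounding unit. -/

/-- Save `ε` and copy the input vector beyond the registers. -/
def relocate : Program :=
  .seq (block [.idxConst 1 1, .idxConst 2 16, .idxAdd 3 0 2, .valStore 3 0, .idxConst 4 1])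
    (.while (.idxLe 4 0)
      (block [.valLoad 0 4, .idxAdd 5 3 4, .valStore 5 0, .idxAdd 4 4 1]))

/-- The offset 16 keeps the copy clear of both the registers and the original. The field `target`
also records that all cells past the copy are zero; the table of subset sums will start there. -/
structure RelocateInv (n : ℕ) (ε : ℝ) (α : ℕ → ℝ) (m : ℕ) (σ : State) : Prop where
  idx0 : σ.idx 0 = n
  idx1 : σ.idx 1 = 1
  idx3 : σ.idx 3 = n + 16
  idx4 : σ.idx 4 = m + 1
  source : ∀ k < n, σ.val (k + 1) = α k
  eps : σ.val (n + 16) = ε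
  target : ∀ k, σ.val (n + 17 + k) = if k < m then α k else 0

theorem relocate_spec {n : ℕ} {ε : ℝ} {α : ℕ → ℝ} {σ : State} (h0 : σ.idx 0 = n)
    (hε : σ.val 0 = ε) (hα : ∀ k, σ.val (k + 1) = if k < n then α k else 0) :
    Reach relocate σ (6 * n + 7) (RelocateInv n ε α n) := by
  refine Reach.mono (Reach.seq (R := RelocateInv n ε α 0) (d := n * (5 + 1) + 1)
    (Reach.block ?_) fun σ' h' => Reach.while ?_ ?_ h') ?_ fun _ h => h
  · have ht : ∀ k, σ.val (n + 17 + k) = 0 := fun k => by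
      rw [show n + 17 + k = n + 16 + k + 1 by omega, hα, if_neg (by omega)]
    constructor <;> simp (disch := omega) only [List.foldl, Instr.apply, Function.update_of_ne,
      Function.update_self, h0, hε]
    · intro k hk
      simp (disch := omega) only [Function.update_of_ne, hα, if_pos hk]
    · intro k
      simp only [ht, Nat.not_lt_zero, if_false]
  · intro i hi σ h
    refine ⟨by simp only [Test.Holds, h.idx0, h.idx4]; omega, Reach.block ?_⟩
    constructor <;> simp (disch := omega) only [List.foldl, Instr.apply, Function.update_of_ne,
      Function.update_self, h.idx0, h.idx1, h.idx3, h.idx4, h.eps]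
    · intro k hk
      simp (disch := omega) only [Function.update_of_ne, h.source k hk]
    · intro k
      rcases eq_or_ne k i with rfl | hk
      · rw [show n + 17 + k = n + 16 + (k + 1) by omega, Function.update_self, h.source k hi,
          if_pos (by omega)]
      · simp (disch := omega) only [Function.update_of_ne, h.target]
        exact if_congr (by omega) rfl rfl
  · intro σ h
    simp [Test.Holds, h.idx0, h.idx4]
  · simp only [List.length_cons, List.length_nil]; omega

/-- Compute one plus the sum of the input vector, and the factorial of its length. -/
def accumulate : Program :=
  .seq (block [.valLoad 1 3, .idxConst 4 1, .valOfIdx 2 1, .valOfIdx 3 1, .valOfIdx 4 1])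
    (.while (.idxLe 4 0)
      (block [.idxAdd 5 3 4, .valLoad 0 5, .valAdd 3 3 0, .valOfIdx 0 4, .valMul 4 4 0,
        .idxAdd 4 4 1]))

structure AccumulateInv (n : ℕ) (ε : ℝ) (α : ℕ → ℝ) (m : ℕ) (σ : State) : Prop where
  idx0 : σ.idx 0 = n
  idx1 : σ.idx 1 = 1
  idx3 : σ.idx 3 = n + 16
  idx4 : σ.idx 4 = m + 1
  val1 : σ.val 1 = ε
  val2 : σ.val 2 = 1
  val3 : σ.val 3 = 1 + ∑ i ∈ Finset.range m, α i
  val4 : σ.val 4 = m.factorial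
  target : ∀ k, σ.val (n + 17 + k) = if k < n then α k else 0

theorem accumulate_spec {n : ℕ} {ε : ℝ} {α : ℕ → ℝ} {σ : State} (h : RelocateInv n ε α n σ) :
    Reach accumulate σ (8 * n + 7) (AccumulateInv n ε α n) := by
  refine Reach.mono (Reach.seq (R := AccumulateInv n ε α 0) (d := n * (7 + 1) + 1)
    (Reach.block ?_) fun σ' h' => Reach.while ?_ ?_ h') ?_ fun _ h => h
  · constructor <;> simp (disch := omega) only [List.foldl, Instr.apply, Function.update_of_ne,
      Function.update_self, h.idx0, h.idx1, h.idx3, h.eps]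
    · exact Nat.cast_one
    · simp
    · simp
    · intro k
      simp only [h.target]
  · intro i hi σ h
    refine ⟨by simp only [Test.Holds, h.idx0, h.idx4]; omega, Reach.block ?_⟩
    have ht := h.target i
    rw [if_pos hi, show n + 17 + i = n + 16 + (i + 1) by omega] at ht
    constructor <;> simp (disch := omega) only [List.foldl, Instr.apply, Function.update_of_ne,
      Function.update_self, h.idx0, h.idx1, h.idx3, h.idx4, h.val1, h.val2, h.val3, h.val4, ht]
    · rw [Finset.sum_range_succ, add_assoc]
    · rw [Nat.factorial_succ]
      push_cast
      ring
    · intro k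
      simp only [h.target]
  · intro σ h
    simp [Test.Holds, h.idx0, h.idx4]
  · simp only [List.length_cons, List.length_nil]; omega

/-- Compute the rounding unit and set up the table of subset sums. -/
def initTable : Program :=
  block [.valOfIdx 0 0, .valAdd 0 0 0, .valMul 0 0 0, .valMul 5 1 3, .valDiv 5 5 0,
    .idxAdd 6 3 4, .valStore 6 2, .idxConst 7 0, .idxConst 4 1]

structure TableRegs (n : ℕ) (α : ℕ → ℝ) (δ : ℝ) (b : ℕ → ℕ) (m : ℕ) (σ : State) : Prop where
  idx0 : σ.idx 0 = n
  idx1 : σ.idx 1 = 1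
  idx3 : σ.idx 3 = n + 16
  idx4 : σ.idx 4 = m + 1
  idx6 : σ.idx 6 = 2 * n + 17
  idx7 : σ.idx 7 = ∑ i ∈ Finset.range m, b i
  val2 : σ.val 2 = 1
  val3 : σ.val 3 = 1 + ∑ i ∈ Finset.range n, α i
  val4 : σ.val 4 = n.factorial
  val5 : σ.val 5 = δ
  target : ∀ k < n, σ.val (n + 17 + k) = α k

structure TableInv (n : ℕ) (α : ℕ → ℝ) (δ : ℝ) (b : ℕ → ℕ) (m : ℕ) (σ : State) : Prop extends
    TableRegs n α δ b m σ where
  table : ∀ j, σ.val (2 * n + 17 + j) = subsetSumCount b m j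

theorem initTable_spec {n : ℕ} {ε : ℝ} {α : ℕ → ℝ} {σ : State} (b : ℕ → ℕ)
    (h : AccumulateInv n ε α n σ) :
    Reach initTable σ 10
      (TableInv n α (ε * (1 + ∑ i ∈ Finset.range n, α i) / (2 * n) ^ 2) b 0) := by
  refine Reach.block ?_
  have e : n + 16 + (n + 1) = 2 * n + 17 := by omega
  constructor
  · constructor <;> simp (disch := omega) only [List.foldl, Instr.apply, Function.update_of_ne,
      Function.update_self, h.idx0, h.idx1, h.idx3, h.idx4, h.val1, h.val2, h.val3, h.val4, e]
    · simp
    · rw [two_mul, pow_two]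
    · intro k hk
      simp (disch := omega) only [Function.update_of_ne, h.target, if_pos hk]
  · simp (disch := omega) only [List.foldl, Instr.apply, Function.update_of_ne,
      Function.update_self, h.idx3, h.idx4, h.val2, e]
    intro j
    rw [subsetSumCount_zero]
    rcases eq_or_ne j 0 with rfl | hj
    · simp
    · have ht := h.target (n + j)
      rw [if_neg (by omega), show n + 17 + (n + j) = 2 * n + 17 + j by omega] at ht
      simp (disch := omega) only [Function.update_of_ne, ht, if_neg hj]

/-! ### Rounding an entry and updating the table. -/

/-- Round `val[7]` down to a multiple of `val[5]`. -/
def roundLoop : Program :=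
  .while (.valLe 5 7) (block [.valSub 7 7 5, .idxAdd 8 8 1])

/-- Add to the table a copy of it that is shifted by `idx[8]`. -/
def shiftLoop : Program :=
  .while (.idxLt 6 9)
    (block [.idxSub 9 9 1, .idxAdd 5 9 8, .valLoad 0 9, .valLoad 8 5, .valAdd 0 0 8, .valStore 5 0])

/-- Add one item to the table of subset sums. -/
def addItem : Program :=
  .seq (block [.idxAdd 5 3 4, .valLoad 7 5, .idxConst 8 0])
    (.seq roundLoop
      (.seq (block [.idxAdd 9 6 7, .idxAdd 9 9 1])
        (.seq shiftLoop (block [.idxAdd 7 7 8, .idxAdd 4 4 1]))))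

structure RoundInv (n : ℕ) (α : ℕ → ℝ) (δ : ℝ) (b : ℕ → ℕ) (m q : ℕ) (σ : State) : Prop extends
    TableInv n α δ b m σ where
  val7 : σ.val 7 = α m - q * δ
  idx8 : σ.idx 8 = q

/-- The update is done in place from the largest sum downwards, so every entry is read before it
receives its own contribution. After `q` rounds the sources from `∑ b i + 1 - q` upwards are done.
-/
structure ShiftInv (n : ℕ) (α : ℕ → ℝ) (δ : ℝ) (b : ℕ → ℕ) (m q : ℕ) (σ : State) : Prop extends
    TableRegs n α δ b m σ where
  idx8 : σ.idx 8 = b m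
  idx9 : σ.idx 9 = 2 * n + 17 + (∑ i ∈ Finset.range m, b i + 1 - q)
  table : ∀ j, σ.val (2 * n + 17 + j) = subsetSumCount b m j +
    if b m ≤ j ∧ ∑ i ∈ Finset.range m, b i + 1 ≤ j - b m + q then subsetSumCount b m (j - b m)
    else 0

/-- The bounds say that `b m` is the floor of `α m / δ`. Repeated subtraction finds it without a
rounding operation, at a cost linear in `b m`. -/
theorem roundLoop_spec {n : ℕ} {α : ℕ → ℝ} {δ : ℝ} {b : ℕ → ℕ} {m : ℕ} {σ : State}
    (hb : b m * δ ≤ α m) (hb' : α m < (b m + 1) * δ) (h : RoundInv n α δ b m 0 σ) :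
    Reach roundLoop σ (b m * (3 + 1) + 1) (RoundInv n α δ b m (b m)) := by
  have hδ : 0 < δ := by linarith
  refine Reach.while ?_ ?_ h
  · intro q hq σ h
    refine ⟨?_, Reach.block ?_⟩
    · simp only [Test.Holds, h.val5, h.val7]
      have : (q : ℝ) + 1 ≤ b m := by exact_mod_cast hq
      nlinarith
    · constructor
      · constructor
        · constructor <;> simp (disch := omega) only [List.foldl, Instr.apply,
            Function.update_of_ne, h.idx0, h.idx1, h.idx3, h.idx4, h.idx6, h.idx7, h.val2, h.val3,
            h.val4, h.val5]
          intro k hk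
          simp only [h.target k hk]
        · intro j
          simp (disch := omega) only [List.foldl, Instr.apply, Function.update_of_ne, h.table]
      · simp (disch := omega) only [List.foldl, Instr.apply, Function.update_self, h.val7, h.val5]
        push_cast
        ring
      · simp (disch := omega) only [List.foldl, Instr.apply, Function.update_self, h.idx8, h.idx1]
  · intro σ h
    simp only [Test.Holds, h.val5, h.val7]
    linarith

theorem shiftLoop_spec {n : ℕ} {α : ℕ → ℝ} {δ : ℝ} {b : ℕ → ℕ} {m : ℕ} {σ : State}
    (h : ShiftInv n α δ b m 0 σ) :
    Reach shiftLoop σ ((∑ i ∈ Finset.range m, b i + 1) * (7 + 1) + 1)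
      (ShiftInv n α δ b m (∑ i ∈ Finset.range m, b i + 1)) := by
  refine Reach.while ?_ ?_ h
  · intro q hq σ h
    generalize hB : ∑ i ∈ Finset.range m, b i = B at hq
    refine ⟨by simp only [Test.Holds, h.idx6, h.idx9, hB]; omega, Reach.block ?_⟩
    have e : 2 * n + 17 + (B + 1 - q) - 1 = 2 * n + 17 + (B - q) := by omega
    have e' : 2 * n + 17 + (B - q) + b m = 2 * n + 17 + (B - q + b m) := by omega
    have h9 := h.idx9
    have ht := h.table
    have h7 := h.idx7
    simp only [hB] at h9 ht h7
    constructor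
    · constructor <;> simp (disch := omega) only [List.foldl, Instr.apply, Function.update_of_ne,
        Function.update_self, h.idx0, h.idx1, h.idx3, h.idx4, h.idx6, h7, h.idx8, h9, h.val2,
        h.val3, h.val4, h.val5, e, hB]
      intro k hk
      simp (disch := omega) only [Function.update_of_ne, h.target k hk]
    · simp (disch := omega) only [List.foldl, Instr.apply, Function.update_of_ne, h.idx8]
    · simp (disch := omega) only [List.foldl, Instr.apply, Function.update_of_ne,
        Function.update_self, h9, h.idx1, hB]
      omega
    · simp (disch := omega) only [List.foldl, Instr.apply, Function.update_of_ne,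
        Function.update_self, h9, h.idx1, h.idx8, e, e', hB]
      intro j
      rcases eq_or_ne j (B - q + b m) with rfl | hj
      · rw [Function.update_self, ht, ht, if_neg (by omega), if_neg (by omega), if_pos (by omega),
          Nat.add_sub_cancel]
        ring
      · simp (disch := omega) only [Function.update_of_ne, ht]
        congr 1
        exact if_congr (by omega) rfl rfl
  · intro σ h
    simp [Test.Holds, h.idx6, h.idx9]

theorem addItem_spec {n : ℕ} {α : ℕ → ℝ} {δ : ℝ} {b : ℕ → ℕ} {m : ℕ} {σ : State} (hm : m < n)
    (hb : b m * δ ≤ α m) (hb' : α m < (b m + 1) * δ) (h : TableInv n α δ b m σ) :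
    Reach addItem σ (4 * b m + 8 * ∑ i ∈ Finset.range m, b i + 20) (TableInv n α δ b (m + 1)) := by
  refine Reach.mono (Reach.seq (R := RoundInv n α δ b m 0) (Reach.block ?_) fun σ h =>
    Reach.seq (roundLoop_spec hb hb' h) fun σ h =>
    Reach.seq (R := ShiftInv n α δ b m 0) (Reach.block ?_) fun σ h =>
    Reach.seq (shiftLoop_spec h) fun σ h => Reach.block (Q := TableInv n α δ b (m + 1)) ?_)
    ?_ fun _ h => h
  · have ht := h.target m hm
    rw [show n + 17 + m = n + 16 + (m + 1) by omega] at ht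
    constructor
    · constructor
      · constructor <;> simp (disch := omega) only [List.foldl, Instr.apply,
          Function.update_of_ne, h.idx0, h.idx1, h.idx3, h.idx4, h.idx6, h.idx7, h.val2, h.val3,
          h.val4, h.val5]
        intro k hk
        simp only [h.target k hk]
      · intro j
        simp (disch := omega) only [List.foldl, Instr.apply, Function.update_of_ne, h.table]
    · simp (disch := omega) only [List.foldl, Instr.apply, Function.update_self,
        h.idx3, h.idx4, ht]
      simp
    · simp (disch := omega) only [List.foldl, Instr.apply, Function.update_self]
  · constructor
    · constructor <;> simp (disch := omega) only [List.foldl, Instr.apply,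
        Function.update_of_ne, h.idx0, h.idx1, h.idx3, h.idx4, h.idx6, h.idx7, h.val2, h.val3,
        h.val4, h.val5]
      exact h.target
    · simp (disch := omega) only [List.foldl, Instr.apply, Function.update_of_ne, h.idx8]
    · simp (disch := omega) only [List.foldl, Instr.apply, Function.update_self,
        Function.update_of_ne, h.idx6, h.idx7, h.idx1]
      omega
    · intro j
      simp (disch := omega) only [List.foldl, Instr.apply, h.table]
      split_ifs with hj
      -- At `q = 0` the condition only selects sources beyond the maximal sum, where the count
      -- vanishes.
      · rw [subsetSumCount_eq_zero b m (j - b m) (by omega), add_zero]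
      · rw [add_zero]
  · constructor
    · constructor <;> simp (disch := omega) only [List.foldl, Instr.apply, Function.update_self,
        Function.update_of_ne, h.idx0, h.idx1, h.idx3, h.idx4, h.idx6, h.idx7, h.idx8, h.val2,
        h.val3, h.val4, h.val5]
      · rw [Finset.sum_range_succ]
      · exact h.target
    · intro j
      simp (disch := omega) only [List.foldl, Instr.apply, h.table, subsetSumCount_succ]
      congr 1
      exact if_congr (by omega) rfl rfl
  · simp only [List.length_cons, List.length_nil]; omega

/-! ### Evaluation and the whole program. -/

/-- Evaluate the approximate volume from the table of subset sums. -/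
def evaluate : Program :=
  .seq (block [.valSub 11 2 2, .valSub 10 2 2, .valAdd 6 2 2, .valSub 6 6 3, .valAdd 5 5 5,
      .idxConst 8 0, .idxAdd 5 6 8, .idxAdd 9 6 7])
    (.seq (.while (.idxLe 5 9)
      (.seq (.ite (.valLt 11 6) (block [.valLoad 0 5, .valMul 0 0 6, .valAdd 10 10 0]) .skip)
        (block [.valAdd 6 6 5, .idxAdd 5 5 1])))
      (block [.valDiv 0 10 4]))

structure EvaluateInv (n : ℕ) (δ c : ℝ) (B : ℕ) (N : ℕ → ℝ) (q : ℕ) (p : ℝ) (σ : State) :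
    Prop where
  idx1 : σ.idx 1 = 1
  idx5 : σ.idx 5 = 2 * n + 17 + q
  idx9 : σ.idx 9 = 2 * n + 17 + B
  val4 : σ.val 4 = n.factorial
  val5 : σ.val 5 = 2 * δ
  val6 : σ.val 6 = c + q * (2 * δ)
  val10 : σ.val 10 = p
  val11 : σ.val 11 = 0
  table : ∀ j, σ.val (2 * n + 17 + j) = N j

theorem evaluate_spec {n : ℕ} {α : ℕ → ℝ} {δ : ℝ} {b : ℕ → ℕ} {σ : State}
    (h : TableInv n α δ b n σ) :
    Reach evaluate σ (10 * ∑ i ∈ Finset.range n, b i + 30) (fun σ' => σ'.output =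
      (∑ j ∈ Finset.range (∑ i ∈ Finset.range n, b i + 1), subsetSumCount b n j *
        max 0 (1 - ∑ i ∈ Finset.range n, α i + j * (2 * δ))) / n.factorial) := by
  set B := ∑ i ∈ Finset.range n, b i with hB
  set c := 1 - ∑ i ∈ Finset.range n, α i with hc
  let f : ℕ → ℝ := fun q => ∑ j ∈ Finset.range q, subsetSumCount b n j * max 0 (c + j * (2 * δ))
  have hf : ∀ q, f (q + 1) = f q + subsetSumCount b n q * max 0 (c + q * (2 * δ)) :=
    fun q => Finset.sum_range_succ _ _
  refine Reach.mono (Reach.seq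
    (R := fun σ => EvaluateInv n δ c B (subsetSumCount b n) 0 (f 0) σ)
    (Reach.block ?_) fun σ h =>
    Reach.seq (R := fun σ => EvaluateInv n δ c B (subsetSumCount b n) (B + 1) (f (B + 1)) σ)
      (Reach.while (I := fun q σ => EvaluateInv n δ c B (subsetSumCount b n) q (f q) σ)
        (c := 8) ?_ ?_ h) fun σ h => Reach.block (Q := fun σ => σ.output = f (B + 1) / n.factorial)
        ?_) ?_ fun _ h => h
  · constructor <;> simp (disch := omega) only [List.foldl, Instr.apply, Function.update_self,
        Function.update_of_ne, h.idx1, h.idx6, h.idx7, h.val2, h.val3, h.val4, h.val5]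
    · ring
    · ring
    · simp only [hc, Nat.cast_zero]
      ring
    · simp [f]
    · ring
    · exact h.table
  · intro q hq σ h
    refine ⟨by simp only [Test.Holds, h.idx5, h.idx9]; omega, ?_⟩
    have hite : Reach (.ite (.valLt 11 6)
        (block [.valLoad 0 5, .valMul 0 0 6, .valAdd 10 10 0]) .skip) σ 5
        (EvaluateInv n δ c B (subsetSumCount b n) q (f (q + 1))) := by
      by_cases ht : (Test.valLt 11 6).Holds σ
      · have hblock : Reach (block [.valLoad 0 5, .valMul 0 0 6, .valAdd 10 10 0]) σ 4
            (EvaluateInv n δ c B (subsetSumCount b n) q (f (q + 1))) := by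
          refine Reach.block ?_
          constructor <;> simp (disch := omega) only [List.foldl, Instr.apply,
            Function.update_self, Function.update_of_ne, h.idx1, h.idx5, h.idx9, h.val4, h.val5,
            h.val6, h.val10, h.val11, h.table]
          · simp only [Test.Holds, h.val11, h.val6] at ht
            rw [hf, max_eq_right ht.le]
          · exact fun _ => trivial
        obtain ⟨σ', t, h1, h2, h3⟩ := hblock
        exact ⟨σ', _, .ite_true ht h1, by omega, h3⟩
      · refine ⟨σ, _, .ite_false ht (.skip σ), by omega, ?_⟩
        simp only [Test.Holds, h.val11, h.val6, not_lt] at ht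
        -- Skipping the addition is right because the positive part is zero.
        rwa [hf, max_eq_left ht, mul_zero, add_zero]
    refine Reach.seq hite fun σ h => Reach.block ?_
    constructor <;> simp (disch := omega) only [List.foldl, Instr.apply,
      Function.update_self, Function.update_of_ne, h.idx1, h.idx5, h.idx9, h.val4, h.val5,
      h.val6, h.val10, h.val11]
    · omega
    · push_cast
      ring
    · exact h.table
  · intro σ h
    simp [Test.Holds, h.idx5, h.idx9]
  · simp (disch := omega) only [List.foldl, Instr.apply, Function.update_self, State.output,
      h.val10, h.val4]
  · simp only [List.length_cons, List.length_nil]; omega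

/-- Approximate the volume of the knapsack dual polytope: round the entries of the vector down to
multiples of a unit, count the subsets with each rounded sum, and use that the volume times `n!` is
the sum of `max 0 (1 - ∑ i, s i * a i)` over all sign vectors `s`. -/
def volumeProgram : Program :=
  .seq relocate (.seq accumulate (.seq initTable (.seq (.while (.idxLe 4 0) addItem) evaluate)))

theorem volumeProgram_spec {n L : ℕ} (ε : ℝ) (a : Fin n → ℕ) {α : ℕ → ℝ} {δ : ℝ} {b : ℕ → ℕ}
    (hα : ∀ k, α k = if h : k < n then (a ⟨k, h⟩ : ℝ) else 0)
    (hδ : δ = ε * (1 + ∑ i ∈ Finset.range n, α i) / (2 * n) ^ 2)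
    (hb : ∀ i < n, b i * δ ≤ α i) (hb' : ∀ i < n, α i < (b i + 1) * δ)
    (hL : ∑ i ∈ Finset.range n, b i ≤ L) :
    Reach volumeProgram (input ε a) (100 * (n + 1) * (L + 1)) (fun σ' => σ'.output =
      (∑ j ∈ Finset.range (∑ i ∈ Finset.range n, b i + 1), subsetSumCount b n j *
        max 0 (1 - ∑ i ∈ Finset.range n, α i + j * (2 * δ))) / n.factorial) := by
  subst hδ
  refine Reach.mono (Reach.seq (relocate_spec (n := n) (α := α) rfl rfl ?_) fun σ h =>
    Reach.seq (accumulate_spec h) fun σ h => Reach.seq (initTable_spec b h) fun σ h =>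
    Reach.seq (Reach.while (I := TableInv n α _ b) (m := n) (c := 12 * L + 20) ?_ ?_ h)
      fun σ h => evaluate_spec h) ?_ fun _ h => h
  · intro k
    simp only [input, Nat.add_sub_cancel, Nat.succ_ne_zero, if_false, hα]
    split_ifs <;> rfl
  · intro m hm σ h
    refine ⟨by simp only [Test.Holds, h.idx0, h.idx4]; omega,
      (addItem_spec hm (hb m hm) (hb' m hm) h).mono ?_ fun _ h => h⟩
    have h1 : ∑ i ∈ Finset.range (m + 1), b i ≤ ∑ i ∈ Finset.range n, b i :=
      Finset.sum_le_sum_of_subset (Finset.range_mono hm)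
    rw [Finset.sum_range_succ] at h1
    omega
  · intro σ h
    simp [Test.Holds, h.idx0, h.idx4]
  · nlinarith [Nat.zero_le (n * L)]

end RealRAM

/-! ### Error analysis. -/

open scoped symmDiff

theorem sum_symmDiff {n : ℕ} (B : Finset (Fin n)) (F : Finset (Fin n) → ℝ) :
    ∑ A, F (A ∆ B) = ∑ A, F A :=
  Equiv.sum_comp (symmDiff_left_involutive B).toPerm F

theorem signVec_symmDiff {ι : Type*} [DecidableEq ι] (A B : Finset ι) (i : ι) :
    signVec (A ∆ B) i = -(signVec A i * signVec B i) := by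
  unfold signVec
  by_cases hA : i ∈ A <;> by_cases hB : i ∈ B <;> simp [Finset.mem_symmDiff, hA, hB]

/-- The sum over all sign vectors `s` of the positive part of `1 - s • a`. -/
noncomputable def signSum {n : ℕ} (a : Fin n → ℝ) : ℝ :=
  ∑ A : Finset (Fin n), max 0 (1 - ∑ i, signVec A i * a i)

/-- Average over groups of four sign vectors, obtained by flipping the sign at `i` and by negating
all signs. -/
theorem le_signSum {n : ℕ} (a : Fin n → ℝ) (i : Fin n) : 2 ^ n * (1 + |a i|) ≤ 2 * signSum a := by
  let F : Finset (Fin n) → ℝ := fun A => max 0 (1 - ∑ i, signVec A i * a i)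
  have hneg : ∀ A, ∑ j, signVec (A ∆ Finset.univ) j * a j = -∑ j, signVec A j * a j := by
    intro A
    rw [← Finset.sum_neg_distrib]
    refine Finset.sum_congr rfl fun j _ => ?_
    rw [signVec_symmDiff]
    simp [signVec]
  have hflip : ∀ A, ∑ j, signVec (A ∆ {i}) j * a j =
      ∑ j, signVec A j * a j - 2 * (signVec A i * a i) := by
    intro A
    have h : ∀ j, signVec (A ∆ {i}) j * a j =
        signVec A j * a j - if j = i then 2 * (signVec A i * a i) else 0 := by
      intro j
      rw [signVec_symmDiff]
      by_cases hj : j = i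
      · subst hj
        simp only [signVec, Finset.mem_singleton, if_true]
        ring
      · simp [signVec, hj]
    simp only [h, Finset.sum_sub_distrib, Finset.sum_ite_eq', Finset.mem_univ, if_true]
  have h4 : ∀ A, 2 * (1 + |a i|) ≤ F A + F (A ∆ {i}) + F (A ∆ Finset.univ) +
      F (A ∆ {i} ∆ Finset.univ) := by
    intro A
    have hy : |a i| = |signVec A i * a i| := by rw [abs_mul, abs_signVec, one_mul]
    simp only [F, hneg, hflip, hy]
    generalize ∑ j, signVec A j * a j = x
    generalize signVec A i * a i = y
    have h1 := le_max_left 0 (1 - x)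
    have h2 := le_max_right 0 (1 - x)
    have h3 := le_max_left 0 (1 - (x - 2 * y))
    have h4 := le_max_right 0 (1 - (x - 2 * y))
    have h5 := le_max_left 0 (1 - -x)
    have h6 := le_max_right 0 (1 - -x)
    have h7 := le_max_left 0 (1 - -(x - 2 * y))
    have h8 := le_max_right 0 (1 - -(x - 2 * y))
    -- Two of the four terms suffice: `(1 + x) + (1 - (x - 2 * y))` if `y ≥ 0`, and `(1 - x) + (1 +
    -- (x - 2 * y))` if `y < 0`.
    rcases abs_cases y with ⟨h, _⟩ | ⟨h, _⟩ <;> rw [h] <;> linarith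
  have hsum := Finset.sum_le_sum fun A (_ : A ∈ (Finset.univ : Finset (Finset (Fin n)))) => h4 A
  rw [Finset.sum_add_distrib, Finset.sum_add_distrib, Finset.sum_add_distrib,
    sum_symmDiff {i} fun A => F (A ∆ Finset.univ), sum_symmDiff, sum_symmDiff] at hsum
  simp only [Finset.sum_const, Finset.card_univ, Fintype.card_finset, Fintype.card_fin,
    nsmul_eq_mul] at hsum
  push_cast at hsum
  have : signSum a = ∑ A, F A := rfl
  linarith

theorem sum_le_signSum {n : ℕ} (hn : 1 ≤ n) (a : Fin n → ℝ) (ha : ∀ i, 0 ≤ a i) :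
    2 ^ n * (1 + ∑ i, a i) ≤ 2 * n * signSum a := by
  have h := Finset.sum_le_sum fun i (_ : i ∈ (Finset.univ : Finset (Fin n))) => le_signSum a i
  simp only [abs_of_nonneg (ha _), ← Finset.mul_sum, Finset.sum_add_distrib, Finset.sum_const,
    Finset.card_univ, Fintype.card_fin, nsmul_eq_mul, mul_one] at h
  have hn' : (1 : ℝ) ≤ n := by exact_mod_cast hn
  have : (2 : ℝ) ^ n * (1 + ∑ i, a i) ≤ 2 ^ n * (n + ∑ i, a i) := by gcongr
  linarith

theorem sum_finset_fin {n : ℕ} {a : Fin n → ℝ} {α : ℕ → ℝ} (hα : ∀ i : Fin n, α i = a i)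
    (g : ℝ → ℝ) :
    ∑ A : Finset (Fin n), g (∑ i ∈ A, a i) =
      ∑ A ∈ (Finset.range n).powerset, g (∑ i ∈ A, α i) := by
  refine Finset.sum_bij (fun A _ => A.map Fin.valEmbedding) ?_ ?_ ?_ ?_
  · intro A _
    rw [Finset.mem_powerset]
    intro k hk
    obtain ⟨i, _, rfl⟩ := Finset.mem_map.1 hk
    exact Finset.mem_range.2 i.2
  · intro A _ B _ h
    exact Finset.map_injective _ h
  · intro B hB
    refine ⟨Finset.univ.filter fun i : Fin n => (i : ℕ) ∈ B, Finset.mem_univ _, ?_⟩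
    ext k
    simp only [Finset.mem_map, Finset.mem_filter, Finset.mem_univ, true_and, Fin.valEmbedding_apply]
    constructor
    · rintro ⟨i, hi, rfl⟩
      exact hi
    · intro hk
      exact ⟨⟨k, Finset.mem_range.1 (Finset.mem_powerset.1 hB hk)⟩, hk, rfl⟩
  · intro A _
    simp [Finset.sum_map, hα]

/-- Reindexing by complements makes the subset sums enter with a plus sign. -/
theorem signSum_eq_sum_powerset {n : ℕ} {a : Fin n → ℝ} {α : ℕ → ℝ}
    (hα : ∀ i : Fin n, α i = a i) :
    signSum a = ∑ A ∈ (Finset.range n).powerset,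
      max 0 (1 - ∑ i ∈ Finset.range n, α i + 2 * ∑ i ∈ A, α i) := by
  have hS : ∑ i ∈ Finset.range n, α i = ∑ i, a i := by
    rw [Finset.sum_range]
    exact Finset.sum_congr rfl fun i _ => hα i
  rw [← sum_finset_fin hα fun x => max 0 (1 - ∑ i ∈ Finset.range n, α i + 2 * x), signSum,
    ← sum_symmDiff Finset.univ]
  refine Finset.sum_congr rfl fun A _ => ?_
  congr 1
  have h : ∀ j, signVec (A ∆ Finset.univ) j * a j = a j - 2 * if j ∈ A then a j else 0 := by
    intro j
    rw [signVec_symmDiff]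
    by_cases hj : j ∈ A <;> simp [signVec, hj]
    ring
  simp only [h, hS, Finset.sum_sub_distrib, ← Finset.mul_sum, Finset.sum_ite_mem, Finset.univ_inter]
  ring

theorem abs_sum_powerset_sub_le {n : ℕ} {α β : ℕ → ℝ} {δ : ℝ} (c : ℝ)
    (h : ∀ i < n, |β i - α i| ≤ δ) (hδ : 0 ≤ δ) :
    |∑ A ∈ (Finset.range n).powerset, max 0 (c + 2 * ∑ i ∈ A, β i) -
      ∑ A ∈ (Finset.range n).powerset, max 0 (c + 2 * ∑ i ∈ A, α i)| ≤ 2 ^ n * (2 * (n * δ)) := by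
  rw [← Finset.sum_sub_distrib]
  refine (Finset.abs_sum_le_sum_abs _ _).trans ?_
  calc _ ≤ ∑ A ∈ (Finset.range n).powerset, 2 * (n * δ) := Finset.sum_le_sum fun A hA => ?_
    _ = 2 ^ n * (2 * (n * δ)) := by simp
  have hA' := Finset.mem_powerset.1 hA
  have h1 : |∑ i ∈ A, β i - ∑ i ∈ A, α i| ≤ n * δ := by
    rw [← Finset.sum_sub_distrib]
    calc _ ≤ ∑ i ∈ A, |β i - α i| := Finset.abs_sum_le_sum_abs _ _
      _ ≤ ∑ i ∈ A, δ := Finset.sum_le_sum fun i hi => h i (Finset.mem_range.1 (hA' hi))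
      _ = A.card * δ := by simp
      _ ≤ n * δ := by
        gcongr
        simpa using Finset.card_le_card hA'
  rw [max_comm 0, max_comm 0]
  calc _ ≤ |(c + 2 * ∑ i ∈ A, β i) - (c + 2 * ∑ i ∈ A, α i)| := abs_max_sub_max_le_abs _ _ _
    _ = 2 * |∑ i ∈ A, β i - ∑ i ∈ A, α i| := by
      rw [add_sub_add_left_eq_sub, ← mul_sub, abs_mul, abs_two]
    _ ≤ _ := by linarith

theorem theorem1 :
    ∃ (P : RealRAM.Program) (C : ℝ),
      ∀ (n : ℕ) (_ : 1 ≤ n) (a : Fin n → ℕ) (ε : ℝ) (_ : 0 < ε) (_ : ε < 1),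
        ∃ (σ : RealRAM.State) (t : ℕ),
          RealRAM.Runs P (RealRAM.input ε a) σ t ∧
          (t : ℝ) ≤ C * (n : ℝ) ^ 10 * ε⁻¹ ^ 6 ∧
          (1 - ε) * volume.real (knapsackDualPolytope a) ≤ σ.output ∧
          σ.output ≤ (1 + ε) * volume.real (knapsackDualPolytope a) := by
  refine ⟨RealRAM.volumeProgram, 1000, fun n hn a ε hε hε1 => ?_⟩
  have hn' : (1 : ℝ) ≤ n := by exact_mod_cast hn
  let α : ℕ → ℝ := fun k => if h : k < n then (a ⟨k, h⟩ : ℝ) else 0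
  have hα : ∀ i : Fin n, α i = (a i : ℝ) := fun i => by simp [α]
  have hα0 : ∀ k, 0 ≤ α k := fun k => by simp only [α]; split_ifs <;> positivity
  set S := ∑ i ∈ Finset.range n, α i with hS
  have hS0 : 0 ≤ S := Finset.sum_nonneg fun i _ => hα0 i
  have hS' : S = ∑ i, (a i : ℝ) := by
    rw [hS, Finset.sum_range]
    exact Finset.sum_congr rfl fun i _ => hα i
  set δ := ε * (1 + S) / (2 * n) ^ 2 with hδ
  have hδ0 : 0 < δ := by positivity
  let b : ℕ → ℕ := fun i => ⌊α i / δ⌋₊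
  have hb : ∀ i, b i * δ ≤ α i := fun i =>
    (le_div_iff₀ hδ0).1 (Nat.floor_le (div_nonneg (hα0 i) hδ0.le))
  have hb' : ∀ i, α i < (b i + 1) * δ := fun i => (div_lt_iff₀ hδ0).1 (Nat.lt_floor_add_one _)
  have hL : ∑ i ∈ Finset.range n, b i ≤ ⌊(2 * n) ^ 2 / ε⌋₊ := by
    refine Nat.le_floor ?_
    have h1 : (∑ i ∈ Finset.range n, (b i : ℝ)) * δ ≤ S := by
      rw [Finset.sum_mul]
      exact Finset.sum_le_sum fun i _ => hb i
    push_cast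
    -- The summand 1 in `1 + S` keeps `δ` positive for `a = 0`; `S ≤ 1 + S` removes the dependence
    -- on `a`.
    have h2 : S / δ ≤ (2 * n) ^ 2 / ε := by
      rw [hδ, div_le_div_iff₀ (by positivity) hε]
      have : (2 * (n : ℝ)) ^ 2 * (ε * (1 + S) / (2 * n) ^ 2) = ε * (1 + S) := by field_simp
      rw [this]
      nlinarith
    exact ((le_div_iff₀ hδ0).2 h1).trans h2
  obtain ⟨σ, t, hrun, ht, hout⟩ := RealRAM.volumeProgram_spec ε a (fun _ => rfl) hδ
    (fun i _ => hb i) (fun i _ => hb' i) hL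
  refine ⟨σ, t, hrun, ?_, ?_⟩
  · have hLr : (⌊(2 * n) ^ 2 / ε⌋₊ : ℝ) ≤ (2 * n) ^ 2 * ε⁻¹ := Nat.floor_le (by positivity)
    have hε' : 1 ≤ ε⁻¹ := (one_le_inv₀ hε).2 hε1.le
    have ht' : (t : ℝ) ≤ 100 * (n + 1) * (⌊(2 * n) ^ 2 / ε⌋₊ + 1) := by exact_mod_cast ht
    calc (t : ℝ) ≤ 100 * (n + 1) * (⌊(2 * n) ^ 2 / ε⌋₊ + 1) := ht'
      -- The ones are absorbed by `1 ≤ n` and `1 ≤ n ^ 2 * ε⁻¹`, whence `100 * 2 * 5 = 1000`.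
      _ ≤ 100 * (n + n) * ((2 * n) ^ 2 * ε⁻¹ + n ^ 2 * ε⁻¹) := by
        gcongr
        exact one_le_mul_of_one_le_of_one_le (one_le_pow₀ hn') hε'
      _ = 1000 * (n : ℝ) ^ 3 * ε⁻¹ ^ 1 := by ring
      _ ≤ 1000 * (n : ℝ) ^ 10 * ε⁻¹ ^ 6 := by
        gcongr
        all_goals first | assumption | norm_num
  · have hV := volume_knapsackDualPolytope hn a
    rw [sum_subsetSumCount_mul b n fun j => max 0 (1 - S + j * (2 * δ))] at hout
    have hcongr : ∑ A ∈ (Finset.range n).powerset,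
        max 0 (1 - S + ((∑ i ∈ A, b i : ℕ) : ℝ) * (2 * δ)) =
        ∑ A ∈ (Finset.range n).powerset, max 0 (1 - S + 2 * ∑ i ∈ A, b i * δ) := by
      refine Finset.sum_congr rfl fun A _ => ?_
      rw [← Finset.sum_mul]
      push_cast
      ring_nf
    have herr := abs_sum_powerset_sub_le (n := n) (α := α) (β := fun i => b i * δ) (1 - S)
      (fun i _ => abs_le.2 ⟨by linarith [hb' i], by linarith [hb i]⟩) hδ0.le
    rw [← hcongr, ← signSum_eq_sum_powerset hα] at herr
    have hlow := sum_le_signSum hn (fun i => (a i : ℝ)) fun i => Nat.cast_nonneg _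
    rw [← hS'] at hlow
    have hbound : 2 ^ n * (2 * (n * δ)) ≤ ε * signSum fun i => (a i : ℝ) := by
      -- The denominator `(2 * n) ^ 2` of `δ` is chosen for this: one factor `2 * n` pays for the
      -- error per term, the other for the lower bound on `signSum`.
      have : 2 ^ n * (2 * (n * δ)) = ε * ((2 ^ n * (1 + S)) / (2 * n)) := by
        rw [hδ]
        field_simp
      rw [this]
      gcongr
      rw [div_le_iff₀ (by positivity)]
      linarith
    have herr' := abs_le.1 (herr.trans hbound)
    change _ = signSum (fun i => (a i : ℝ)) / _ at hV
    rw [hout, hV, ← mul_div_assoc (1 - ε), ← mul_div_assoc (1 + ε)]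
    constructor <;> refine div_le_div_of_nonneg_right ?_ (Nat.cast_nonneg _) <;>
      linarith [herr'.1, herr'.2]
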